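/- Let $G$ be a finite simple $(2,3)$-bipartite graph, that is, a graph whose vertex set has a bipartition $(A,B)$ (each edge joins a vertex of $A$ to a vertex of $B$) such that every vertex of $A$ has degree at most $2$ and every vertex of $B$ has degree at most $3$. Then $ch'_s(G)\le 6$. Here a strong edge coloring of $G$ is a coloring of the edges of $G$ in which each color class is an induced matching, and the list strong chromatic index $ch'_s(G)$ is the smallest integer $k$ such that for every assignment of a set $L(e)$ of colors with $|L(e)|\ge k$ to each edge $e\in E(G)$ there is a strong edge coloring $\varphi$ of $G$ with $\varphi(e)\in L(e)$ for every $e\in E(G)$. -/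

import Mathlib

universe u v

namespace SimpleGraph

/-- The subgraph formed by the edges of colour `c` together with their end vertices. -/
def edgeColorClass {V : Type u} (G : SimpleGraph V) {C : Type v} (φ : G.edgeSet → C) (c : C) :
    G.Subgraph where
  verts := {x | ∃ y, ∃ h : G.Adj x y, φ ⟨s(x, y), h⟩ = c}
  Adj x y := ∃ h : G.Adj x y, φ ⟨s(x, y), h⟩ = c
  adj_sub := fun h => h.1
  edge_vert := fun {_ y} h => ⟨y, h⟩
  symm := ⟨fun x y ⟨h, hc⟩ => ⟨h.symm, by
    have e : (⟨s(y, x), h.symm⟩ : G.edgeSet) = ⟨s(x, y), h⟩ := Subtype.ext Sym2.eq_swap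
    rw [e, hc]⟩⟩

/-- A strong edge colouring: every colour class is an induced matching. -/
def IsStrongEdgeColoring {V : Type u} (G : SimpleGraph V) {C : Type v} (φ : G.edgeSet → C) :
    Prop :=
  ∀ c, (G.edgeColorClass φ c).IsMatching ∧ (G.edgeColorClass φ c).IsInduced

/-- For all lists (of any cardinality at least `k`, colours from any type) on the edges there is
a strong edge colouring that takes the colour of each edge from the list of that edge. -/
def IsStrongEdgeChoosable {V : Type u} (G : SimpleGraph V) (k : ℕ) : Prop :=
  ∀ (C : Type v) (L : G.edgeSet → Set C), (∀ e, (k : ℕ∞) ≤ (L e).encard) →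
    ∃ φ : G.edgeSet → C, G.IsStrongEdgeColoring φ ∧ ∀ e, φ e ∈ L e

/-- The least `k` for which `G` is strongly edge `k`-choosable (`⊤` if there is none). -/
noncomputable def listStrongChromaticIndex {V : Type u} (G : SimpleGraph V) : ℕ∞ :=
  ⨅ (k : ℕ) (_ : IsStrongEdgeChoosable.{u, v} G k), (k : ℕ∞)

/-- `G` has a bipartition `(A, B)` of its vertex set with all degrees at most `a` in `A` and
at most `b` in `B`. -/
def IsDegreeBoundedBipartite {V : Type u} (G : SimpleGraph V) [G.LocallyFinite] (a b : ℕ) :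
    Prop :=
  ∃ A B : Set V, A ∪ B = Set.univ ∧ G.IsBipartiteWith A B ∧
    (∀ x ∈ A, G.degree x ≤ a) ∧ (∀ x ∈ B, G.degree x ≤ b)

end SimpleGraph

open Finset

/-- A choice of colours from the lists `L` on the elements of `U` in which conflicting elements
receive different colours. -/
def ListColorable {E : Type*} {C : Type*} (conf : E → E → Prop) (L : E → Finset C)
    (U : Finset E) : Prop :=
  ∃ φ : E → C, (∀ e ∈ U, φ e ∈ L e) ∧ ∀ e ∈ U, ∀ f ∈ U, conf e f → φ e ≠ φ f

/-! ### List colouring of chains and cycles -/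

theorem exists_mem_ne_ne {C : Type*} {X : Finset C} (h : 3 ≤ #X) (x y : C) :
    ∃ c ∈ X, c ≠ x ∧ c ≠ y := by
  classical
  obtain ⟨c, hc, hx⟩ := exists_mem_notMem_of_card_lt_card (s := {x, y}) (t := X)
    (by have := card_le_two (a := x) (b := y); omega)
  exact ⟨c, hc, by simpa using hx⟩

theorem exists_mem_ne_ne_ne {C : Type*} {X : Finset C} (h : 4 ≤ #X) (x y z : C) :
    ∃ c ∈ X, c ≠ x ∧ c ≠ y ∧ c ≠ z := by
  classical
  obtain ⟨c, hc, hx⟩ := exists_mem_notMem_of_card_lt_card (s := {x, y, z}) (t := X)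
    (by have := card_le_three (a := x) (b := y) (c := z); omega)
  exact ⟨c, hc, by simpa using hx⟩

/-- List colouring of the complete graph on five vertices without the edge `a₁b₂`. -/
theorem exists_coloring_completeGraph_five_minus_edge {C : Type*} {A₁ B₁ S A₂ B₂ : Finset C}
    (hA₁ : 2 ≤ #A₁) (hB₁ : 3 ≤ #B₁) (hS : 3 ≤ #S) (hA₂ : 4 ≤ #A₂) (hB₂ : 3 ≤ #B₂) :
    ∃ a₁ ∈ A₁, ∃ b₁ ∈ B₁, ∃ s ∈ S, ∃ a₂ ∈ A₂, ∃ b₂ ∈ B₂,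
      a₁ ≠ b₁ ∧ s ≠ a₁ ∧ s ≠ b₁ ∧ a₂ ≠ a₁ ∧ a₂ ≠ b₁ ∧ a₂ ≠ s ∧ b₂ ≠ b₁ ∧ b₂ ≠ s ∧ b₂ ≠ a₂ := by
  classical
  by_cases hd : ∃ c ∈ A₁, c ∈ B₂
  · obtain ⟨c, h1, h2⟩ := hd
    obtain ⟨s, hs, hsc⟩ := exists_mem_ne (by omega) c (s := S)
    obtain ⟨b, hb, hbc, hbs⟩ := exists_mem_ne_ne hB₁ c s
    obtain ⟨a, ha, hac, hab, has⟩ := exists_mem_ne_ne_ne hA₂ c b s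
    exact ⟨c, h1, b, hb, s, hs, a, ha, c, h2, by grind⟩
  · push Not at hd
    obtain ⟨a₁, ha₁⟩ := card_pos.1 (show 0 < #A₁ by omega)
    obtain ⟨b₁, hb₁, hba⟩ := exists_mem_ne (by omega) a₁ (s := B₁)
    obtain ⟨s, hs, hsa, hsb⟩ := exists_mem_ne_ne hS a₁ b₁
    obtain ⟨a₂, ha₂, h21, h22, h23⟩ := exists_mem_ne_ne_ne hA₂ a₁ b₁ s
    obtain ⟨b₂, hb₂, h31, h32⟩ := exists_mem_ne_ne hB₂ b₁ s
    by_cases hne : b₂ = a₂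
    swap
    · exact ⟨a₁, ha₁, b₁, hb₁, s, hs, a₂, ha₂, b₂, hb₂, by grind⟩
    subst hne
    by_cases hA : ∃ c ∈ A₂, c ≠ a₁ ∧ c ≠ b₁ ∧ c ≠ s ∧ c ≠ b₂
    · obtain ⟨c, hc, _⟩ := hA
      exact ⟨a₁, ha₁, b₁, hb₁, s, hs, c, hc, b₂, hb₂, by grind⟩
    by_cases hB : ∃ c ∈ B₂, c ≠ b₁ ∧ c ≠ s ∧ c ≠ b₂
    · obtain ⟨c, hc, _⟩ := hB
      exact ⟨a₁, ha₁, b₁, hb₁, s, hs, b₂, ha₂, c, hc, by grind⟩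
    -- The greedy choice is now stuck: `B₂` lies in `{b₁, s, b₂}` and `A₂` in `{a₁, b₁, s, b₂}`, and
    -- by cardinality both are equalities.
    push Not at hA hB
    have hbB : b₁ ∈ B₂ := by
      by_contra h
      obtain ⟨c, hc, h1, h2⟩ := exists_mem_ne_ne hB₂ s b₂
      exact h2 (hB c hc (fun e => h (e ▸ hc)) h1)
    have hsB : s ∈ B₂ := by
      by_contra h
      obtain ⟨c, hc, h1, h2⟩ := exists_mem_ne_ne hB₂ b₁ b₂
      exact h2 (hB c hc h1 (fun e => h (e ▸ hc)))
    have haA : a₁ ∈ A₂ := by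
      by_contra h
      obtain ⟨c, hc, h1, h2, h3⟩ := exists_mem_ne_ne_ne hA₂ b₁ s b₂
      exact h3 (hA c hc (fun e => h (e ▸ hc)) h1 h2)
    -- Recolouring the first vertex by `y` frees `a₁` for the fourth. Disjointness of `A₁` and `B₂`
    -- keeps `y` and `a₁` away from `b₁`, `s` and `b₂`.
    obtain ⟨y, hy, hya⟩ := exists_mem_ne hA₁ a₁
    refine ⟨y, hy, b₁, hb₁, s, hs, a₁, haA, b₂, hb₂, ?_⟩
    have := hd y hy
    grind

/-- Greedy colouring of step 0 removes at most three colours from `A 1` and only two from `B 1`,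
since `a 0` and `b 1` do not conflict. Sizes 5 and 5 thus become 2 and 3, the initial hypotheses
again. The last two steps form the complete graph on five vertices minus an edge. -/
theorem exists_chain_coloring {C : Type*} (n : ℕ) (A B S : ℕ → Finset C)
    (hA₀ : 2 ≤ #(A 0)) (hB₀ : 3 ≤ #(B 0))
    (hA : ∀ i, 0 < i → i ≤ n → 5 ≤ #(A i)) (hB : ∀ i, 0 < i → i ≤ n → 5 ≤ #(B i))
    (hAn : 4 ≤ #(A (n + 1))) (hBn : 3 ≤ #(B (n + 1)))
    (hS : ∀ i ≤ n, 3 ≤ #(S i)) :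
    ∃ a b s : ℕ → C, (∀ i ≤ n + 1, a i ∈ A i ∧ b i ∈ B i ∧ a i ≠ b i) ∧
      ∀ i ≤ n, s i ∈ S i ∧ a i ≠ a (i + 1) ∧ b i ≠ a (i + 1) ∧ b i ≠ b (i + 1) ∧
        s i ≠ a i ∧ s i ≠ b i ∧ s i ≠ a (i + 1) ∧ s i ≠ b (i + 1) := by
  classical
  induction n generalizing A B S with
  | zero =>
    obtain ⟨a₁, ha₁, b₁, hb₁, s, hs, a₂, ha₂, b₂, hb₂, h⟩ :=
      exists_coloring_completeGraph_five_minus_edge hA₀ hB₀ (hS 0 le_rfl) hAn hBn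
    refine ⟨fun i => if i = 0 then a₁ else a₂, fun i => if i = 0 then b₁ else b₂, fun _ => s,
      fun i hi => ?_, fun i hi => ?_⟩
    · obtain rfl | rfl : i = 0 ∨ i = 1 := by omega
      · simp; grind
      · simp; grind
    · obtain rfl : i = 0 := by omega
      simp; grind
  | succ n ih =>
    obtain ⟨a₀, ha₀⟩ := card_pos.1 (show 0 < #(A 0) by omega)
    obtain ⟨b₀, hb₀, hba⟩ := exists_mem_ne (by omega) a₀ (s := B 0)
    obtain ⟨s₀, hs₀, hsa, hsb⟩ := exists_mem_ne_ne (hS 0 (by omega)) a₀ b₀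
    have h1 := hA 1 (by omega) (by omega)
    have h2 := hB 1 (by omega) (by omega)
    have h3 := le_card_sdiff {a₀, b₀, s₀} (A 1)
    have h4 := le_card_sdiff {b₀, s₀} (B 1)
    have h5 := card_le_three (a := a₀) (b := b₀) (c := s₀)
    have h6 := card_le_two (a := b₀) (b := s₀)
    obtain ⟨a, b, s, hab, hs⟩ := ih
      (fun i => if i = 0 then A 1 \ {a₀, b₀, s₀} else A (i + 1))
      (fun i => if i = 0 then B 1 \ {b₀, s₀} else B (i + 1)) (fun i => S (i + 1))
      (by simp only [if_true]; omega) (by simp only [if_true]; omega)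
      (fun i hi hn => by simpa [hi.ne'] using hA (i + 1) (by omega) (by omega))
      (fun i hi hn => by simpa [hi.ne'] using hB (i + 1) (by omega) (by omega))
      (by simpa using hAn) (by simpa using hBn) (fun i hi => hS (i + 1) (by omega))
    refine ⟨fun i => i.casesOn a₀ a, fun i => i.casesOn b₀ b, fun i => i.casesOn s₀ s, ?_, ?_⟩
    · rintro (_ | i) hi
      · exact ⟨ha₀, hb₀, hba.symm⟩
      · have := hab i (by omega)
        rcases i with _ | i
        · simp at this ⊢
          tauto
        · simpa using this
    · rintro (_ | i) hi
      · have := hab 0 (by omega)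
        simp at this ⊢
        grind
      · exact hs i (by omega)

/-- List colouring of the edges leaving a cycle of length `k`: `a i` and `b i` are the colours of
the two halves of the `i`-th step of the cycle, `s i` that of the edge leaving it. -/
theorem exists_cyclic_coloring {C : Type*} (k : ℕ) (A B S : ℕ → Finset C)
    (hA : ∀ i, 5 ≤ #(A i)) (hB : ∀ i, 5 ≤ #(B i)) (hS : ∀ i, 3 ≤ #(S i)) :
    ∃ a b s : ℕ → C, (∀ i ≤ k + 1, a i ∈ A i ∧ b i ∈ B i ∧ s i ∈ S i ∧ a i ≠ b i ∧
        s i ≠ a i ∧ s i ≠ b i) ∧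
      (∀ i ≤ k, a i ≠ a (i + 1) ∧ b i ≠ a (i + 1) ∧ b i ≠ b (i + 1) ∧
        s (i + 1) ≠ a i ∧ s (i + 1) ≠ b i) ∧
      a (k + 1) ≠ a 0 ∧ b (k + 1) ≠ a 0 ∧ b (k + 1) ≠ b 0 ∧
        s 0 ≠ a (k + 1) ∧ s 0 ≠ b (k + 1) := by
  classical
  -- Reserve three colours for `s 0` and colour `a 0`, `b 0` outside them. Then `s 0` can come last,
  -- as only the two colours of the final step can block it. Two colours remain in each of `A 0` and
  -- `B 0`, just enough.
  obtain ⟨S₀, hS₀, hS₀c⟩ := exists_subset_card_eq (hS 0)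
  have h1 := le_card_sdiff S₀ (A 0)
  have h2 := le_card_sdiff S₀ (B 0)
  have hA0 := hA 0
  have hB0 := hB 0
  obtain ⟨p, hp⟩ := card_pos.1 (show 0 < #(A 0 \ S₀) by omega)
  obtain ⟨q, hq, hqp⟩ := exists_mem_ne (by omega) p (s := B 0 \ S₀)
  obtain ⟨t, ht, htp, htq⟩ := exists_mem_ne_ne (hS 1) p q
  rw [mem_sdiff] at hp hq
  rcases k with _ | n
  · obtain ⟨a, ha, h⟩ := exists_mem_ne_ne_ne (by have := hA 1; omega) p q t (X := A 1)
    obtain ⟨b, hb, hb'⟩ := exists_mem_notMem_of_card_lt_card (s := {p, q, t, a}) (t := B 1)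
      (by have := hB 1; have := card_le_four (a := p) (b := q) (c := t) (d := a); omega)
    obtain ⟨s, hs, hsa, hsb⟩ := exists_mem_ne_ne hS₀c.ge a b
    have hs' := hS₀ hs
    simp at hb'
    refine ⟨fun i => if i = 0 then p else a, fun i => if i = 0 then q else b,
      fun i => if i = 0 then s else t, fun i hi => ?_, fun i hi => ?_, ?_⟩
    · obtain rfl | rfl : i = 0 ∨ i = 1 := by omega
      · simp; grind
      · simp; grind
    · obtain rfl : i = 0 := by omega
      simp; grind
    · simp; grind
  · have h3 := le_card_sdiff {p, q, t} (A 1)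
    have h4 := le_card_sdiff {q, t} (B 1)
    have h5 := card_le_three (a := p) (b := q) (c := t)
    have h6 := card_le_two (a := q) (b := t)
    have h7 := le_card_sdiff {p} (A (n + 2))
    have h8 := le_card_sdiff {p, q} (B (n + 2))
    have h9 := card_le_two (a := p) (b := q)
    rw [card_singleton] at h7
    have hA1 := hA 1
    have hB1 := hB 1
    have hA2 := hA (n + 2)
    have hB2 := hB (n + 2)
    -- With `a 0 = p`, `b 0 = q`, `s 1 = t` fixed, the cycle opens into a chain whose end lists have
    -- sizes 2, 3 and 4, 3.
    obtain ⟨a, b, s, hab, hs⟩ := exists_chain_coloring n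
      (fun i => if i = 0 then A 1 \ {p, q, t} else if i = n + 1 then A (n + 2) \ {p} else A (i + 1))
      (fun i => if i = 0 then B 1 \ {q, t} else if i = n + 1 then B (n + 2) \ {p, q} else B (i + 1))
      (fun i => S (i + 2)) (by simp only [if_true]; omega) (by simp only [if_true]; omega)
      (fun i hi hn => by
        simpa [hi.ne', show i ≠ n + 1 by omega] using hA (i + 1))
      (fun i hi hn => by
        simpa [hi.ne', show i ≠ n + 1 by omega] using hB (i + 1))
      (by simp; omega) (by simp; omega) (fun i _ => hS (i + 2))
    obtain ⟨s₀, hs₀, hsa, hsb⟩ := exists_mem_ne_ne hS₀c.ge (a (n + 1)) (b (n + 1))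
    have hs₀' := hS₀ hs₀
    have hlast := hab (n + 1) le_rfl
    have hfirst := hab 0 (by omega)
    simp at hlast hfirst
    have hmem : ∀ i ≤ n + 1, a i ∈ A (i + 1) ∧ b i ∈ B (i + 1) ∧ a i ≠ b i := by
      intro i hi
      have := hab i hi
      by_cases h0 : i = 0
      · subst h0; simp; tauto
      · by_cases hn : i = n + 1
        · subst hn; tauto
        · simpa [h0, hn] using this
    refine ⟨fun i => i.casesOn p a, fun i => i.casesOn q b,
      fun i => i.casesOn s₀ (fun j => j.casesOn t s), ?_, ?_, ?_⟩
    · rintro (_ | _ | i) hi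
      · simp; grind
      · have := hmem 0 (by omega)
        simp at this ⊢; grind
      · have := hmem (i + 1) (by omega)
        have := hs i (by omega)
        simp at this ⊢; grind
    · rintro (_ | i) hi
      · simp; grind
      · have := hs i (by omega)
        simp at this ⊢; grind
    · simp; grind

/-! ### Minimal uncolourable sets -/

theorem exists_minimal_not_listColorable {E C : Type*} {conf : E → E → Prop} {L : E → Finset C}
    {F : Finset E} (hF : ¬ ListColorable conf L F) :
    ∃ U ⊆ F, ¬ ListColorable conf L U ∧ ∀ T, T ⊂ U → ListColorable conf L T := by
  classical
  induction F using Finset.strongInduction with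
  | H F ih =>
    by_cases h : ∀ T, T ⊂ F → ListColorable conf L T
    · exact ⟨F, Subset.rfl, hF, h⟩
    · push Not at h
      obtain ⟨T, hT, hTn⟩ := h
      obtain ⟨U, hU, h⟩ := ih T hT hTn
      exact ⟨U, hU.trans hT.1, h⟩

/-- In a minimal set without list colouring every part `S` admits lists, obtained by deleting the
colours of the conflicting elements outside `S`, from which `S` cannot be coloured. -/
theorem exists_residual_lists {E C : Type*} [DecidableEq E] {conf : E → E → Prop}
    [DecidableRel conf]
    (hsymm : ∀ e f, conf e f → conf f e) {L : E → Finset C} {U : Finset E}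
    (hU : ¬ ListColorable conf L U) (hmin : ∀ T, T ⊂ U → ListColorable conf L T)
    {S : Finset E} (hS : ∃ e ∈ U, e ∈ S) :
    ∃ L' : E → Finset C, (∀ e, #(L e) ≤ #(L' e) + #{f ∈ U \ S | conf e f}) ∧
      ¬ ListColorable conf L' S := by
  classical
  obtain ⟨φ, hφL, hφ⟩ := hmin (U \ S) (by
    refine (ssubset_iff_of_subset sdiff_subset).2 ?_
    obtain ⟨e, he, hs⟩ := hS
    exact ⟨e, he, by simp [hs]⟩)
  refine ⟨fun e => L e \ image φ {f ∈ U \ S | conf e f}, fun e => ?_, ?_⟩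
  · dsimp only
    have h1 := le_card_sdiff (image φ {f ∈ U \ S | conf e f}) (L e)
    have h2 := card_image_le (f := φ) (s := {f ∈ U \ S | conf e f})
    omega
  · rintro ⟨ψ, hψL, hψ⟩
    have key : ∀ e ∈ S, ∀ f ∈ U, f ∉ S → conf e f → ψ e ≠ φ f := by
      intro e he f hf hfS hc h
      have := (mem_sdiff.1 (hψL e he)).2
      exact this (mem_image.2 ⟨f, by simp [hf, hfS, hc], h.symm⟩)
    refine hU ⟨fun e => if e ∈ S then ψ e else φ e, fun e he => ?_, fun e he f hf hc => ?_⟩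
    · dsimp only
      split_ifs with h
      · exact (mem_sdiff.1 (hψL e h)).1
      · exact hφL e (by simp [he, h])
    · dsimp only
      split_ifs with h hfS hfS
      · exact hψ e h f hfS hc
      · exact key e h f hf hfS hc
      · exact (key f hfS e he h (hsymm _ _ hc)).symm
      · exact hφ e (by simp [he, h]) f (by simp [hf, hfS]) hc

/-- Every element of a minimal set without list colouring has many conflicts in that set. -/
theorem card_le_card_conflicts {E C : Type*} [DecidableEq E] {conf : E → E → Prop}
    [DecidableRel conf]
    (hsymm : ∀ e f, conf e f → conf f e) (hirr : ∀ e, ¬ conf e e) {L : E → Finset C} {U : Finset E}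
    (hU : ¬ ListColorable conf L U) (hmin : ∀ T, T ⊂ U → ListColorable conf L T)
    {e : E} (he : e ∈ U) : #(L e) ≤ #{f ∈ U | conf e f} := by
  obtain ⟨L', hL', hn⟩ := exists_residual_lists hsymm hU hmin (S := {e}) ⟨e, he, by simp⟩
  have h0 : L' e = ∅ := by
    by_contra h
    obtain ⟨c, hc⟩ := nonempty_iff_ne_empty.2 h
    refine hn ⟨fun _ => c, by simpa using hc, ?_⟩
    intro x hx y hy hxy
    rw [mem_singleton] at hx hy
    subst hx; subst hy
    exact absurd hxy (hirr _)
  have h1 := hL' e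
  rw [h0, card_empty, zero_add] at h1
  exact h1.trans (card_le_card (filter_subset_filter _ sdiff_subset))

/-! ### Shortest alternating cycles -/

namespace SimpleGraph

variable {V : Type u}

/-- Two edges, given as ordered pairs of end vertices with the first one in a fixed side of a
bipartite graph, that are distinct and share a vertex or are joined by an edge. -/
def EdgeConflict (G : SimpleGraph V) (p q : V × V) : Prop :=
  p ≠ q ∧ (G.Adj p.1 q.2 ∨ G.Adj q.1 p.2)

theorem EdgeConflict.symm {G : SimpleGraph V} {p q : V × V} (h : G.EdgeConflict p q) :
    G.EdgeConflict q p :=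
  ⟨h.1.symm, h.2.symm⟩

/-- The sequences `v` and `m` describe a cycle `v 0, m 0, v 1, m 1, …, v k = v 0` of `G` in which
the vertices `v i` belong to `W`. -/
structure IsAlternatingCycle (G : SimpleGraph V) (W : Set V) (k : ℕ) (v m : ℕ → V) : Prop where
  two_le : 2 ≤ k
  mem : ∀ i < k, v i ∈ W
  adj : ∀ i < k, G.Adj (v i) (m i)
  adj_succ : ∀ i < k, G.Adj (v (i + 1)) (m i)
  closed : v k = v 0
  injOn_left : ∀ i < k, ∀ j < k, v i = v j → i = j
  injOn_right : ∀ i < k, ∀ j < k, m i = m j → i = j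

/-- A walk that never turns back can be continued forever, so in a finite graph it returns to a
vertex. Hypothesis `hA` is the degree bound two for the neighbours of `W`. -/
theorem exists_isAlternatingCycle [Finite V] {G : SimpleGraph V} {W : Set V} (hne : W.Nonempty)
    (hA : ∀ b ∈ W, ∀ a x y, G.Adj b a → G.Adj x a → G.Adj y a → x ≠ b → y ≠ b → x = y)
    (hnext : ∀ b ∈ W, ∀ a, G.Adj b a → ∃ b' ∈ W, b' ≠ b ∧ G.Adj b' a)
    (hdeg : ∀ b ∈ W, ∀ a, ∃ a' ≠ a, G.Adj b a') :
    ∃ k v m, G.IsAlternatingCycle W k v m := by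
  classical
  let St := {p : V × V // p.1 ∈ W ∧ G.Adj p.1 p.2}
  have hstep : ∀ p : St, ∃ q : St, q.1.1 ≠ p.1.1 ∧ G.Adj q.1.1 p.1.2 ∧ q.1.2 ≠ p.1.2 := by
    rintro ⟨⟨b, a⟩, hb, hab⟩
    obtain ⟨b', hb', hne, hadj⟩ := hnext b hb a hab
    obtain ⟨a', ha', hadj'⟩ := hdeg b' hb' a
    exact ⟨⟨(b', a'), hb', hadj'⟩, hne, hadj, ha'⟩
  choose nxt hnxt using hstep
  obtain ⟨b₀, hb₀⟩ := hne
  -- Any neighbour will do; the vertex to be avoided is a dummy.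
  obtain ⟨a₀, -, ha₀⟩ := hdeg b₀ hb₀ b₀
  let st : ℕ → St := fun n => nxt^[n] ⟨(b₀, a₀), hb₀, ha₀⟩
  have hst : ∀ n, st (n + 1) = nxt (st n) := fun n => Function.iterate_succ_apply' _ _ _
  let v : ℕ → V := fun n => (st n).1.1
  let m : ℕ → V := fun n => (st n).1.2
  have hv : ∀ n, v n ∈ W := fun n => (st n).2.1
  have h1 : ∀ n, G.Adj (v n) (m n) := fun n => (st n).2.2
  have h2 : ∀ n, v (n + 1) ≠ v n ∧ G.Adj (v (n + 1)) (m n) ∧ m (n + 1) ≠ m n := by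
    intro n
    simp only [v, m, hst]
    exact hnxt (st n)
  have hrep : ∃ d, 0 < d ∧ ∃ i, v i = v (i + d) := by
    obtain ⟨i, j, hij, hne⟩ := Finite.exists_ne_map_eq_of_infinite v
    rcases lt_or_gt_of_ne hij with h | h
    · exact ⟨j - i, by omega, i, by rw [hne]; congr 1; omega⟩
    · exact ⟨i - j, by omega, j, by rw [← hne]; congr 1; omega⟩
  -- The gap `d` is least over all positions of the walk, so any `d` consecutive `v`'s are distinct.
  obtain ⟨hd, i, hi⟩ := Nat.find_spec hrep
  set d := Nat.find hrep
  have hmin : ∀ e, 0 < e → e < d → ∀ j, v j ≠ v (j + e) := by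
    intro e he hed j hj
    exact Nat.find_min hrep hed ⟨he, j, hj⟩
  have hinj : ∀ x y, x < y → y < x + d → v x ≠ v y := by
    intro x y hxy hyd h
    refine hmin (y - x) (by omega) (by omega) x ?_
    rw [h]; congr 1; omega
  have hd2 : 2 ≤ d := by
    by_contra hlt
    have : d = 1 := by omega
    rw [this] at hi
    exact (h2 i).1 hi.symm
  have hminj : ∀ x y, x < y → i ≤ x → y < i + d → m x ≠ m y := by
    intro x y hxy hix hyd h
    have e1 : v y = v (x + 1) := hA (v x) (hv x) (m x) _ _ (h1 x) (h ▸ h1 y) (h2 x).2.1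
      (hinj x y hxy (by omega)).symm (h2 x).1
    by_cases hxy1 : y = x + 1
    · subst hxy1
      exact (h2 x).2.2 h.symm
    · exact hinj (x + 1) y (by omega) (by omega) e1.symm
  refine ⟨d, fun t => v (i + t), fun t => m (i + t), hd2, fun t _ => hv _, fun t _ => h1 _,
    fun t _ => (h2 _).2.1, hi.symm, ?_, ?_⟩
  · intro x hx y hy h
    by_contra hne
    rcases lt_or_gt_of_ne hne with hlt | hlt
    · exact hinj _ _ (by omega) (by omega) h
    · exact hinj _ _ (by omega) (by omega) h.symm
  · intro x hx y hy h
    by_contra hne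
    rcases lt_or_gt_of_ne hne with hlt | hlt
    · exact hminj _ _ (by omega) (by omega) (by omega) h
    · exact hminj _ _ (by omega) (by omega) (by omega) h.symm

/-- A vertex off a shortest alternating cycle that is adjacent to two of its vertices in `W`
exists only when the cycle has length two. -/
theorem IsAlternatingCycle.eq_two_of_chord {G : SimpleGraph V} {W : Set V} {k : ℕ} {v m : ℕ → V}
    (h : G.IsAlternatingCycle W k v m)
    (hmin : ∀ l v m, G.IsAlternatingCycle W l v m → k ≤ l) {z : V} (hz : ∀ l < k, z ≠ m l)
    {i j : ℕ} (hij : i < j) (hj : j < k) (hi' : G.Adj (v i) z) (hj' : G.Adj (v j) z) :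
    k = 2 := by
  -- Close the arc from `v i` to `v j` through `z`. Minimality then forces `i = 0` and `j = k - 1`.
  have hle : k ≤ j - i + 1 := by
    refine hmin _ (fun t => if t ≤ j - i then v (i + t) else v i)
      (fun t => if t < j - i then m (i + t) else z)
      ⟨by omega, ?_, ?_, ?_, ?_, ?_, ?_⟩
    · intro t ht
      rw [if_pos (by omega)]
      exact h.mem _ (by omega)
    · intro t ht
      rw [if_pos (by omega)]
      split_ifs with ht'
      · exact h.adj _ (by omega)
      · rwa [show i + t = j by omega]
    · intro t ht
      by_cases ht' : t < j - i
      · rw [if_pos (by omega), if_pos ht']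
        exact h.adj_succ (i + t) (by omega)
      · rwa [if_neg (by omega), if_neg ht']
    · simp
    · intro x hx y hy hxy
      rw [if_pos (by omega), if_pos (by omega)] at hxy
      have := h.injOn_left _ (by omega) _ (by omega) hxy
      omega
    · intro x hx y hy hxy
      split_ifs at hxy with h1 h2 h2
      · have := h.injOn_right _ (by omega) _ (by omega) hxy
        omega
      · exact absurd hxy.symm (hz _ (by omega))
      · exact absurd hxy (hz _ (by omega))
      · omega
  obtain rfl : i = 0 := by omega
  obtain rfl : j = k - 1 := by omega
  have hk := h.two_le
  -- Now `v (k - 1), m (k - 1), v 0, z` is itself a cycle of length two.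
  have hle2 : k ≤ 2 := by
    have hn : v (k - 1) ≠ v 0 := by
      intro e
      have := h.injOn_left _ (by omega) _ (by omega) e
      omega
    have hc : G.Adj (v 0) (m (k - 1)) := by
      have := h.adj_succ (k - 1) (by omega)
      rwa [show k - 1 + 1 = k by omega, h.closed] at this
    have hm := hz (k - 1) (by omega)
    refine hmin _ (fun t => if t = 1 then v 0 else v (k - 1))
      (fun t => if t = 0 then m (k - 1) else z) ⟨le_rfl, ?_, ?_, ?_, ?_, ?_, ?_⟩
    · intro t ht
      split_ifs
      · exact h.mem _ (by omega)
      · exact h.mem _ (by omega)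
    · intro t ht
      obtain rfl | rfl : t = 0 ∨ t = 1 := by omega
      · simpa using h.adj (k - 1) (by omega)
      · simpa using hi'
    · intro t ht
      obtain rfl | rfl : t = 0 ∨ t = 1 := by omega
      · simpa using hc
      · simpa using hj'
    · simp
    · intro x hx y hy hxy
      obtain rfl | rfl : x = 0 ∨ x = 1 := by omega
      all_goals obtain rfl | rfl : y = 0 ∨ y = 1 := by omega
      all_goals simp_all [hn.symm]
    · intro x hx y hy hxy
      obtain rfl | rfl : x = 0 ∨ x = 1 := by omega
      all_goals obtain rfl | rfl : y = 0 ∨ y = 1 := by omega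
      all_goals simp_all [hm.symm]
  omega

/-! ### Counting conflicts -/

section Counting

variable {G : SimpleGraph V} [G.LocallyFinite] {B : Set V}

theorem card_le_degree_of_fst_eq {X : Finset (V × V)} {b : V}
    (hX : ∀ q ∈ X, q.1 = b ∧ G.Adj b q.2) : #X ≤ G.degree b := by
  rw [← G.card_neighborFinset_eq_degree]
  refine card_le_card_of_injOn Prod.snd (fun q hq => ?_) (fun p hp q hq h => ?_)
  · simpa using (hX q hq).2
  · exact Prod.ext ((hX p hp).1.trans (hX q hq).1.symm) h

theorem card_le_three_of_adj
    (hA : ∀ b ∈ B, ∀ a x y, G.Adj b a → G.Adj x a → G.Adj y a → x ≠ b → y ≠ b → x = y)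
    (hB : ∀ b ∈ B, G.degree b ≤ 3) {b a : V} (hb : b ∈ B) (hab : G.Adj b a)
    {X : Finset (V × V)}
    (hX : ∀ q ∈ X, q.1 ∈ B ∧ G.Adj q.1 q.2 ∧ q.1 ≠ b ∧ G.Adj q.1 a) : #X ≤ 3 := by
  rcases X.eq_empty_or_nonempty with rfl | ⟨p, hp⟩
  · simp
  · refine le_trans (card_le_degree_of_fst_eq (G := G) (b := p.1) fun q hq => ?_)
      (hB _ (hX p hp).1)
    have e : q.1 = p.1 :=
      hA b hb a _ _ hab (hX q hq).2.2.2 (hX p hp).2.2.2 (hX q hq).2.2.1 (hX p hp).2.2.1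
    exact ⟨e, e ▸ (hX q hq).2.1⟩

-- The three sets in `key` have at most `deg b`, 3 and `deg b - 1` elements but total at least 7, so
-- `deg b = 3`. If `(b, a')` is in `U`, the second set for `a'` cannot be empty. Otherwise the first
-- set has at most two elements, so the third must reach every neighbour of `b` except `a`.
open Classical in
theorem degree_eq_three_and_exists_adj
    (hA : ∀ b ∈ B, ∀ a x y, G.Adj b a → G.Adj x a → G.Adj y a → x ≠ b → y ≠ b → x = y)
    (hB : ∀ b ∈ B, G.degree b ≤ 3) {U : Finset (V × V)}
    (hU : ∀ q ∈ U, q.1 ∈ B ∧ G.Adj q.1 q.2)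
    (h6 : ∀ p ∈ U, 6 ≤ #{q ∈ U | G.EdgeConflict p q}) {b a : V} (hba : (b, a) ∈ U) :
    G.degree b = 3 ∧ ∀ a', G.Adj b a' → ∃ b' ≠ b, G.Adj b' a' ∧ ∃ a'', (b', a'') ∈ U := by
  have key : ∀ a, (b, a) ∈ U → 7 ≤ #{q ∈ U | q.1 = b} + #{q ∈ U | q.1 ≠ b ∧ G.Adj q.1 a} +
      #{q ∈ U | q.1 ≠ b ∧ G.Adj b q.2 ∧ q.2 ≠ a} := by
    intro a hba
    have hsub : ({q ∈ U | G.EdgeConflict (b, a) q} : Finset (V × V)) ⊆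
        ({q ∈ U | q.1 = b}.erase (b, a) ∪ {q ∈ U | q.1 ≠ b ∧ G.Adj q.1 a}) ∪
          {q ∈ U | q.1 ≠ b ∧ G.Adj b q.2 ∧ q.2 ≠ a} := by
      intro q hq
      rw [mem_filter] at hq
      have hq' := hU q hq.1
      simp only [mem_filter, mem_union, mem_erase]
      by_cases h1 : q.1 = b
      · exact Or.inl (Or.inl ⟨hq.2.1.symm, hq.1, h1⟩)
      · by_cases h2 : G.Adj q.1 a
        · exact Or.inl (Or.inr ⟨hq.1, h1, h2⟩)
        · refine Or.inr ⟨hq.1, h1, hq.2.2.resolve_right h2, ?_⟩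
          rintro rfl
          exact h2 hq'.2
    have h1 := (h6 _ hba).trans (card_le_card hsub)
    have h2 := card_union_le ({q ∈ U | q.1 = b}.erase (b, a) ∪ {q ∈ U | q.1 ≠ b ∧ G.Adj q.1 a})
      {q ∈ U | q.1 ≠ b ∧ G.Adj b q.2 ∧ q.2 ≠ a}
    have h3 := card_union_le ({q ∈ U | q.1 = b}.erase (b, a)) {q ∈ U | q.1 ≠ b ∧ G.Adj q.1 a}
    have h4 := card_erase_add_one (s := {q ∈ U | q.1 = b}) (a := (b, a)) (by simp [hba])
    omega
  have hb : b ∈ B := (hU _ hba).1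
  have hab : G.Adj b a := (hU _ hba).2
  have hX2 : ∀ a, G.Adj b a → #{q ∈ U | q.1 ≠ b ∧ G.Adj q.1 a} ≤ 3 := by
    intro a hab
    refine card_le_three_of_adj hA hB hb hab fun q hq => ?_
    rw [mem_filter] at hq
    exact ⟨(hU q hq.1).1, (hU q hq.1).2, hq.2⟩
  have hX1 : #{q ∈ U | q.1 = b} ≤ G.degree b := by
    refine card_le_degree_of_fst_eq fun q hq => ?_
    rw [mem_filter] at hq
    exact ⟨hq.2, hq.2 ▸ (hU q hq.1).2⟩
  have himg : ∀ a, image Prod.snd ({q ∈ U | q.1 ≠ b ∧ G.Adj b q.2 ∧ q.2 ≠ a} : Finset (V × V)) ⊆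
      (G.neighborFinset b).erase a := by
    intro a x hx
    obtain ⟨q, hq, rfl⟩ := mem_image.1 hx
    rw [mem_filter] at hq
    simpa using ⟨hq.2.2.2, hq.2.2.1⟩
  have hinj : ∀ a, #(image Prod.snd ({q ∈ U | q.1 ≠ b ∧ G.Adj b q.2 ∧ q.2 ≠ a} :
      Finset (V × V))) = #{q ∈ U | q.1 ≠ b ∧ G.Adj b q.2 ∧ q.2 ≠ a} := by
    intro a
    refine card_image_of_injOn fun p hp q hq h => ?_
    rw [mem_coe, mem_filter] at hp hq
    exact Prod.ext (hA b hb p.2 _ _ hp.2.2.1 (hU p hp.1).2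
      ((show p.2 = q.2 from h) ▸ (hU q hq.1).2) hp.2.1 hq.2.1) h
  have herase : ∀ a, G.Adj b a → #((G.neighborFinset b).erase a) + 1 = G.degree b := by
    intro a h
    rw [card_erase_add_one (by simpa using h), G.card_neighborFinset_eq_degree]
  have hB3 := hB b hb
  have k1 := key a hba
  have k2 := hX2 a hab
  have k3 := card_le_card (himg a)
  have k4 := hinj a
  have k5 := herase a hab
  refine ⟨by omega, fun a' ha' => ?_⟩
  by_cases hU' : (b, a') ∈ U
  · have l1 := key a' hU'
    have l2 := hX2 a' ha'
    have l3 := card_le_card (himg a')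
    have l4 := hinj a'
    have l5 := herase a' ha'
    obtain ⟨q, hq⟩ := card_pos.1 (show 0 < #{q ∈ U | q.1 ≠ b ∧ G.Adj q.1 a'} by omega)
    rw [mem_filter] at hq
    exact ⟨q.1, hq.2.1, hq.2.2, q.2, hq.1⟩
  · have hlt : #{q ∈ U | q.1 = b} + 1 ≤ G.degree b := by
      rw [← herase a' ha']
      refine Nat.succ_le_succ (card_le_card_of_injOn Prod.snd (fun q hq => ?_)
        (fun p hp q hq h => ?_))
      · rw [mem_coe, mem_filter] at hq
        have hadj := (hU q hq.1).2
        rw [hq.2] at hadj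
        simp only [coe_erase, coe_neighborFinset, Set.mem_sdiff, mem_neighborSet,
          Set.mem_singleton_iff]
        refine ⟨hadj, fun e => hU' ?_⟩
        rw [← e, ← hq.2]
        exact hq.1
      · rw [mem_coe, mem_filter] at hp hq
        exact Prod.ext (hp.2.trans hq.2.symm) h
    have heq := eq_of_subset_of_card_le (himg a) (by omega)
    have hmem : a' ∈ (G.neighborFinset b).erase a := by
      simp only [mem_erase, mem_neighborFinset]
      exact ⟨fun e => hU' (e ▸ hba), ha'⟩
    rw [← heq] at hmem
    obtain ⟨q, hq, rfl⟩ := mem_image.1 hmem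
    rw [mem_filter] at hq
    exact ⟨q.1, hq.2.1, (hU q hq.1).2, q.2, hq.1⟩

-- If all neighbours of `b` were neighbours of `b'`, conflicts of `(b, a)` would occur only at `b`
-- and `b'`, at most 2 + 3 = 5 of them.
open Classical in
theorem exists_adj_not_adj
    (hA : ∀ b ∈ B, ∀ a x y, G.Adj b a → G.Adj x a → G.Adj y a → x ≠ b → y ≠ b → x = y)
    (hB : ∀ b ∈ B, G.degree b ≤ 3) {U : Finset (V × V)}
    (hU : ∀ q ∈ U, q.1 ∈ B ∧ G.Adj q.1 q.2)
    (h6 : ∀ p ∈ U, 6 ≤ #{q ∈ U | G.EdgeConflict p q}) {b b' a : V} (hba : (b, a) ∈ U)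
    (hb' : b' ∈ B) (hne : b' ≠ b) : ∃ a', G.Adj b a' ∧ ¬ G.Adj b' a' := by
  by_contra! hall
  have hb : b ∈ B := (hU _ hba).1
  have hend : ∀ x y, G.Adj b y → G.Adj x y → x ≠ b → x = b' := fun x y h1 h2 h3 =>
    hA b hb y _ _ h1 h2 (hall y h1) h3 hne
  have hsub : ({q ∈ U | G.EdgeConflict (b, a) q} : Finset (V × V)) ⊆
      {q ∈ U | q.1 = b}.erase (b, a) ∪ {q ∈ U | q.1 = b'} := by
    intro q hq
    rw [mem_filter] at hq
    have hq' := hU q hq.1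
    simp only [mem_filter, mem_union, mem_erase]
    by_cases h1 : q.1 = b
    · exact Or.inl ⟨hq.2.1.symm, hq.1, h1⟩
    · refine Or.inr ⟨hq.1, ?_⟩
      rcases hq.2.2 with h | h
      · exact hend _ _ h hq'.2 h1
      · exact hend _ _ (hU _ hba).2 h h1
  have h1 := (h6 _ hba).trans (card_le_card hsub)
  have h2 := card_union_le ({q ∈ U | q.1 = b}.erase (b, a)) {q ∈ U | q.1 = b'}
  have h4 := card_erase_add_one (s := {q ∈ U | q.1 = b}) (a := (b, a)) (by simp [hba])
  have hX : ∀ b ∈ B, #{q ∈ U | q.1 = b} ≤ 3 := by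
    intro b hb
    refine le_trans (card_le_degree_of_fst_eq (G := G) (b := b) fun q hq => ?_) (hB b hb)
    rw [mem_filter] at hq
    exact ⟨hq.2, hq.2 ▸ (hU q hq.1).2⟩
  have h5 := hX b hb
  have h6 := hX b' hb'
  omega

end Counting

end SimpleGraph

/-! ### Spoked cycles -/

theorem exists_fin_cyclic_coloring {C : Type*} {n : ℕ} (A B S : Fin (n + 2) → Finset C)
    (hA : ∀ i, 5 ≤ #(A i)) (hB : ∀ i, 5 ≤ #(B i)) (hS : ∀ i, 3 ≤ #(S i)) :
    ∃ a b s : Fin (n + 2) → C, ∀ i, a i ∈ A i ∧ b i ∈ B i ∧ s i ∈ S i ∧ a i ≠ b i ∧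
      s i ≠ a i ∧ s i ≠ b i ∧ a i ≠ a (i + 1) ∧ b i ≠ a (i + 1) ∧ b i ≠ b (i + 1) ∧
      s (i + 1) ≠ a i ∧ s (i + 1) ≠ b i := by
  obtain ⟨a, b, s, h1, h2, h3⟩ := exists_cyclic_coloring n (fun i => A (Fin.ofNat _ i))
    (fun i => B (Fin.ofNat _ i)) (fun i => S (Fin.ofNat _ i)) (fun _ => hA _) (fun _ => hB _)
    (fun _ => hS _)
  refine ⟨fun i => a i, fun i => b i, fun i => s i, fun i => ?_⟩
  have h := h1 i (by omega)
  simp only [Fin.ofNat_eq_cast, Fin.cast_val_eq_self] at h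
  refine ⟨h.1, h.2.1, h.2.2.1, h.2.2.2.1, h.2.2.2.2.1, h.2.2.2.2.2, ?_⟩
  simp only [Fin.val_add_one]
  split_ifs with hi
  · subst hi
    exact h3
  · exact h2 i (by have := Fin.val_lt_last hi; omega)

namespace SimpleGraph

variable {V : Type u}

/-- A cycle of `G` without chords through the third neighbours `z i` of its vertices `v i`. -/
structure IsSpokedCycle (G : SimpleGraph V) (W : Set V) {n : ℕ} (v m z : Fin (n + 2) → V) :
    Prop where
  mem : ∀ i, v i ∈ W
  injective_left : Function.Injective v
  injective_right : Function.Injective m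
  adj_iff : ∀ i j, G.Adj (v i) (m j) ↔ i = j ∨ i = j + 1
  adj_spoke_iff : ∀ i j, G.Adj (v i) (z j) ↔ i = j
  mem_of_adj : ∀ i x, G.Adj x (m i) → x ∈ Set.range v
  eq_of_adj : ∀ i y, G.Adj (v i) y → y = z i ∨ y ∈ Set.range m

open Classical in
theorem exists_isSpokedCycle [Finite V] {G : SimpleGraph V} [G.LocallyFinite] {B : Set V}
    (hA : ∀ b ∈ B, ∀ a x y, G.Adj b a → G.Adj x a → G.Adj y a → x ≠ b → y ≠ b → x = y)
    (hB : ∀ b ∈ B, G.degree b ≤ 3) {U : Finset (V × V)} (hne : U.Nonempty)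
    (hU : ∀ q ∈ U, q.1 ∈ B ∧ G.Adj q.1 q.2)
    (h6 : ∀ p ∈ U, 6 ≤ #{q ∈ U | G.EdgeConflict p q}) :
    ∃ (n : ℕ) (v m z : Fin (n + 2) → V), G.IsSpokedCycle {b | ∃ a, (b, a) ∈ U} v m z := by
  set W : Set V := {b | ∃ a, (b, a) ∈ U}
  have hWB : ∀ b ∈ W, b ∈ B := fun b ⟨a, h⟩ => (hU _ h).1
  have hA' : ∀ b ∈ W, ∀ a x y, G.Adj b a → G.Adj x a → G.Adj y a → x ≠ b → y ≠ b → x = y :=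
    fun b hb => hA b (hWB b hb)
  have hdeg : ∀ b ∈ W, #(G.neighborFinset b) = 3 := fun b ⟨a, h⟩ => by
    rw [G.card_neighborFinset_eq_degree]
    exact (degree_eq_three_and_exists_adj hA hB hU h6 h).1
  have hex : ∃ k v m, G.IsAlternatingCycle W k v m := by
    refine exists_isAlternatingCycle ?_ hA' ?_ ?_
    · obtain ⟨p, hp⟩ := hne
      exact ⟨p.1, p.2, hp⟩
    · rintro b ⟨a, h⟩ a' ha'
      obtain ⟨b', hb', hadj, h'⟩ := (degree_eq_three_and_exists_adj hA hB hU h6 h).2 a' ha'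
      exact ⟨b', h', hb', hadj⟩
    · intro b hb a
      obtain ⟨a', ha', hne⟩ := exists_mem_ne (by rw [hdeg b hb]; omega) a
        (s := G.neighborFinset b)
      exact ⟨a', hne, by simpa using ha'⟩
  obtain ⟨v, m, hc⟩ := Nat.find_spec hex
  have hmin : ∀ l v m, G.IsAlternatingCycle W l v m → Nat.find hex ≤ l :=
    fun l v m h => Nat.find_min' hex ⟨v, m, h⟩
  obtain ⟨n, hn⟩ : ∃ n, Nat.find hex = n + 2 := ⟨_, (Nat.sub_add_cancel hc.two_le).symm⟩
  rw [hn] at hc hmin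
  let v' : Fin (n + 2) → V := fun i => v i
  let m' : Fin (n + 2) → V := fun i => m i
  have hv'W : ∀ i, v' i ∈ W := fun i => hc.mem i i.2
  have hv' : Function.Injective v' := fun i j h => Fin.ext (hc.injOn_left i i.2 j j.2 h)
  have hm' : Function.Injective m' := fun i j h => Fin.ext (hc.injOn_right i i.2 j j.2 h)
  have hsucc : ∀ i : Fin (n + 2), i + 1 ≠ i := fun i h => by simp at h
  have hadj : ∀ i, G.Adj (v' i) (m' i) := fun i => hc.adj i i.2
  have hadj1 : ∀ i, G.Adj (v' (i + 1)) (m' i) := by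
    intro i
    have := hc.adj_succ i i.2
    simp only [v', m', Fin.val_add_one]
    split_ifs with hi
    · subst hi
      rw [← hc.closed]
      exact this
    · exact this
  have hend : ∀ i x, G.Adj x (m' i) → x = v' i ∨ x = v' (i + 1) := by
    intro i x hx
    by_cases h : x = v' i
    · exact Or.inl h
    · exact Or.inr (hA' _ (hv'W i) _ _ _ (hadj i) hx (hadj1 i) h (hv'.ne (hsucc i)))
  have hiff : ∀ i j, G.Adj (v' i) (m' j) ↔ i = j ∨ i = j + 1 := by
    intro i j
    constructor
    · intro h
      exact (hend j _ h).imp (fun h => hv' h) (fun h => hv' h)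
    · rintro (rfl | rfl)
      exacts [hadj i, hadj1 j]
  have hz : ∀ i, ∃ z, G.Adj (v' i) z ∧ z ≠ m' i ∧ z ≠ m' (i - 1) := by
    intro i
    obtain ⟨z, hz, h⟩ := exists_mem_ne_ne (hdeg _ (hv'W i)).ge (m' i) (m' (i - 1))
    exact ⟨z, by simpa using hz, h⟩
  choose z hz hz1 hz2 using hz
  have hzm : ∀ i j, z i ≠ m' j := by
    intro i j h
    rcases (hiff i j).1 (h ▸ hz i) with rfl | rfl
    · exact hz1 _ h
    · exact hz2 (j + 1) (by simpa using h)
  have hnb : ∀ i y, G.Adj (v' i) y → y = m' i ∨ y = m' (i - 1) ∨ y = z i := by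
    intro i y hy
    have hsub : ({m' i, m' (i - 1), z i} : Finset V) ⊆ G.neighborFinset (v' i) := by
      intro x hx
      simp only [mem_insert, mem_singleton] at hx
      rw [mem_neighborFinset]
      rcases hx with rfl | rfl | rfl
      · exact hadj i
      · simpa using hadj1 (i - 1)
      · exact hz i
    have hcard : #({m' i, m' (i - 1), z i} : Finset V) = 3 := by
      refine card_eq_three.2 ⟨_, _, _, ?_, (hz1 i).symm, (hz2 i).symm, rfl⟩
      refine hm'.ne fun h => hsucc (i - 1) ?_
      rw [sub_add_cancel]
      exact h
    have heq := eq_of_subset_of_card_le hsub (by rw [hcard, hdeg _ (hv'W i)])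
    have : y ∈ G.neighborFinset (v' i) := by simpa using hy
    rw [← heq] at this
    simpa using this
  -- A shared vertex off the cycle forces length two. Then `v' 0` and `v' 1` have all three
  -- neighbours in common, which `exists_adj_not_adj` excludes.
  have hchord : ∀ (i j : Fin (n + 2)) y, (∀ l, y ≠ m' l) → G.Adj (v' i) y → G.Adj (v' j) y →
      i < j → False := by
    intro i j y hy hi hj hij
    have h2 : n + 2 = 2 := hc.eq_two_of_chord hmin (z := y) (fun l hl => hy ⟨l, hl⟩)
      (i := i) (j := j) hij j.2 hi hj
    obtain rfl : n = 0 := by omega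
    obtain ⟨rfl, rfl⟩ : i = 0 ∧ j = 1 := by
      clear hi hj
      revert i j
      decide
    obtain ⟨a, ha⟩ := hv'W 0
    obtain ⟨x, hx0, hx1⟩ := exists_adj_not_adj hA hB hU h6 ha (hWB _ (hv'W 1))
      (hv'.ne (by decide))
    apply hx1
    have hy0 : y = z 0 := by
      rcases hnb 0 y hi with h | h | h
      exacts [absurd h (hy _), absurd h (hy _), h]
    rcases hnb 0 x hx0 with rfl | rfl | rfl
    · exact (hiff _ _).2 (by decide)
    · exact (hiff _ _).2 (by decide)
    · exact hy0 ▸ hj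
  refine ⟨n, v', m', z, hv'W, hv', hm', hiff, fun i j => ⟨fun h => ?_, ?_⟩, ?_, ?_⟩
  · by_contra hne
    rcases lt_or_gt_of_ne hne with hlt | hlt
    · exact hchord i j _ (hzm j) h (hz j) hlt
    · exact hchord j i _ (hzm j) (hz j) h hlt
  · rintro rfl
    exact hz i
  · intro i x hx
    rcases hend i x hx with rfl | rfl
    exacts [⟨_, rfl⟩, ⟨_, rfl⟩]
  · intro i y hy
    rcases hnb i y hy with rfl | rfl | rfl
    exacts [Or.inr ⟨_, rfl⟩, Or.inr ⟨_, rfl⟩, Or.inl rfl]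

/-- The edges leaving a cycle can be coloured from lists of size five for the edges of the cycle
and of size three for the other edges. -/
theorem IsSpokedCycle.listColorable {G : SimpleGraph V} {W : Set V} {n : ℕ}
    {v m z : Fin (n + 2) → V} (h : G.IsSpokedCycle W v m z) {C : Type v}
    {L : V × V → Finset C} {S : Finset (V × V)}
    (hS : ∀ q ∈ S, q.1 ∈ Set.range v ∧ G.Adj q.1 q.2)
    (hm : ∀ i j, G.Adj (v i) (m j) → 5 ≤ #(L (v i, m j))) (hz : ∀ i, 3 ≤ #(L (v i, z i))) :
    ListColorable G.EdgeConflict L S := by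
  classical
  have hsucc : ∀ i : Fin (n + 2), i + 1 ≠ i := fun i h => by simp at h
  obtain ⟨a, b, s, hab⟩ := exists_fin_cyclic_coloring (fun i => L (v i, m i))
    (fun i => L (v (i + 1), m i)) (fun i => L (v i, z i))
    (fun i => hm _ _ ((h.adj_iff _ _).2 (Or.inl rfl)))
    (fun i => hm _ _ ((h.adj_iff _ _).2 (Or.inr rfl))) hz
  have hzm : ∀ i j, z i ≠ m j := by
    intro i j e
    have h1 := (h.adj_spoke_iff (j + 1) i).1 (e ▸ (h.adj_iff _ _).2 (Or.inr rfl))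
    have h2 := (h.adj_spoke_iff j i).1 (e ▸ (h.adj_iff _ _).2 (Or.inl rfl))
    exact hsucc j (h1.trans h2.symm)
  let g : Fin (n + 2) ⊕ Fin (n + 2) ⊕ Fin (n + 2) → V × V :=
    Sum.elim (fun i => (v i, m i)) (Sum.elim (fun i => (v (i + 1), m i)) (fun i => (v i, z i)))
  let ψ : Fin (n + 2) ⊕ Fin (n + 2) ⊕ Fin (n + 2) → C := Sum.elim a (Sum.elim b s)
  have hg : Function.Injective g := by
    rintro (i | i | i) (j | j | j) e <;>
      simp only [g, Sum.elim_inl, Sum.elim_inr, Prod.mk.injEq] at e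
    · rw [h.injective_left e.1]
    · have := h.injective_left e.1
      rw [h.injective_right e.2] at this
      exact absurd this.symm (hsucc j)
    · exact absurd e.2.symm (hzm _ _)
    · have := h.injective_left e.1
      rw [h.injective_right e.2] at this
      exact absurd this (hsucc j)
    · rw [h.injective_right e.2]
    · exact absurd e.2.symm (hzm _ _)
    · exact absurd e.2 (hzm _ _)
    · exact absurd e.2 (hzm _ _)
    · rw [h.injective_left e.1]
  have hcover : ∀ q ∈ S, ∃ x, g x = q := by
    rintro ⟨b, y⟩ hq
    obtain ⟨⟨i, rfl⟩, hadj⟩ := hS _ hq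
    rcases h.eq_of_adj i y hadj with rfl | ⟨j, rfl⟩
    · exact ⟨Sum.inr (Sum.inr i), rfl⟩
    · rcases (h.adj_iff i j).1 hadj with rfl | rfl
      · exact ⟨Sum.inl i, rfl⟩
      · exact ⟨Sum.inr (Sum.inl j), rfl⟩
  -- The default `a 0` is never used on `S`, which lies in the range of `g`.
  have hext : ∀ x, Function.extend g ψ (fun _ => a 0) (g x) = ψ x := hg.extend_apply _ _
  refine ⟨Function.extend g ψ (fun _ => a 0), fun q hq => ?_, fun p hp q hq hc => ?_⟩
  · obtain ⟨x, rfl⟩ := hcover q hq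
    rw [hext]
    rcases x with i | i | i
    exacts [(hab i).1, (hab i).2.1, (hab i).2.2.1]
  · obtain ⟨x, rfl⟩ := hcover p hp
    obtain ⟨y, rfl⟩ := hcover q hq
    rw [hext, hext]
    obtain ⟨hne, hc⟩ := hc
    have hne' : x ≠ y := fun e => hne (congrArg g e)
    clear hne hp hq hext hcover
    rcases x with i | i | i <;> rcases y with j | j | j <;>
      simp only [g, ψ, Sum.elim_inl, Sum.elim_inr, h.adj_iff, h.adj_spoke_iff,
        add_left_inj] at hc ⊢ <;> have := hab i <;> have := hab j <;> grind

/-! ### The contradiction -/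

/-- Edges with ends in `B` of degree at most three and other ends of degree at most two can be
coloured from lists of size six. -/
theorem listColorable_six [Finite V] {G : SimpleGraph V} [G.LocallyFinite] {B : Set V}
    (hA : ∀ b ∈ B, ∀ a x y, G.Adj b a → G.Adj x a → G.Adj y a → x ≠ b → y ≠ b → x = y)
    (hB : ∀ b ∈ B, G.degree b ≤ 3) {C : Type v} [Nonempty C]
    {L : V × V → Finset C} {F : Finset (V × V)} (hF : ∀ q ∈ F, q.1 ∈ B ∧ G.Adj q.1 q.2)
    (hL : ∀ b a, G.Adj b a → 6 ≤ #(L (b, a))) : ListColorable G.EdgeConflict L F := by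
  classical
  have := Fintype.ofFinite V
  by_contra hn
  obtain ⟨U, hUF, hU, hmin⟩ := exists_minimal_not_listColorable hn
  have hU' : ∀ q ∈ U, q.1 ∈ B ∧ G.Adj q.1 q.2 := fun q hq => hF q (hUF hq)
  have hne : U.Nonempty := by
    rw [nonempty_iff_ne_empty]
    rintro rfl
    exact hU ⟨fun _ => Classical.arbitrary C, by simp, by simp⟩
  have hsymm : ∀ e f, G.EdgeConflict e f → G.EdgeConflict f e := fun _ _ h => h.symm
  have h6 : ∀ p ∈ U, 6 ≤ #{q ∈ U | G.EdgeConflict p q} := fun p hp =>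
    (hL p.1 p.2 (hU' p hp).2).trans
      (card_le_card_conflicts hsymm (fun e he => he.1 rfl) hU hmin hp)
  obtain ⟨n, v, m, z, hc⟩ := exists_isSpokedCycle hA hB hne hU' h6
  -- All edges of `G` at the cycle's `B`-vertices are taken, whether in `U` or not; colouring all of
  -- them is more than needed.
  let S : Finset (V × V) := {q | q.1 ∈ Set.range v ∧ G.Adj q.1 q.2}
  obtain ⟨a, ha⟩ := hc.mem 0
  obtain ⟨L', hL', hn'⟩ := exists_residual_lists hsymm hU hmin (S := S)
    ⟨_, ha, by simpa [S] using (hU' _ ha).2⟩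
  have hvB : ∀ i, v i ∈ B := fun i => by
    obtain ⟨a, ha⟩ := hc.mem i
    exact (hU' _ ha).1
  have hout : ∀ q ∈ U \ S, q.1 ∈ B ∧ G.Adj q.1 q.2 ∧ q.1 ∉ Set.range v := by
    intro q hq
    rw [mem_sdiff] at hq
    have h1 := hU' q hq.1
    refine ⟨h1.1, h1.2, fun h => hq.2 ?_⟩
    simpa [S] using ⟨h, h1.2⟩
  have hz : ∀ i, G.Adj (v i) (z i) := fun i => (hc.adj_spoke_iff i i).2 rfl
  have hsnd : ∀ i, ∀ q ∈ U \ S, G.Adj (v i) q.2 → q.2 = z i := by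
    intro i q hq h
    rcases hc.eq_of_adj i _ h with h | ⟨j, hj⟩
    · exact h
    · exact absurd (hc.mem_of_adj j q.1 (hj ▸ (hout q hq).2.1)) (hout q hq).2.2
  refine hn' (hc.listColorable (fun q hq => by simpa [S] using hq) (fun i j hij => ?_)
    (fun i => ?_))
  · have h1 := hL' (v i, m j)
    have h2 := hL _ _ hij
    have h3 : #{f ∈ U \ S | G.EdgeConflict (v i, m j) f} ≤ 1 := by
      -- Both neighbours of `m j` are on the cycle, so an outside conflict passes through `z i`,
      -- which has at most one neighbour besides `v i`.
      have key : ∀ q ∈ ({f ∈ U \ S | G.EdgeConflict (v i, m j) f} : Finset (V × V)),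
          q.2 = z i ∧ G.Adj q.1 (z i) ∧ q.1 ≠ v i := by
        intro q hq
        rw [mem_filter] at hq
        have ho := hout q hq.1
        rcases hq.2.2 with h | h
        · have e := hsnd i q hq.1 h
          exact ⟨e, e ▸ ho.2.1, fun e => ho.2.2 ⟨i, e.symm⟩⟩
        · exact absurd (hc.mem_of_adj j _ h) ho.2.2
      refine card_le_one.2 fun p hp q hq => ?_
      have hp' := key p hp
      have hq' := key q hq
      exact Prod.ext (hA _ (hvB i) _ _ _ (hz i) hp'.2.1 hq'.2.1 hp'.2.2 hq'.2.2)
        (hp'.1.trans hq'.1.symm)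
    omega
  · have h1 := hL' (v i, z i)
    have h2 := hL _ _ (hz i)
    have h3 : #{f ∈ U \ S | G.EdgeConflict (v i, z i) f} ≤ 3 := by
      refine card_le_three_of_adj hA hB (hvB i) (hz i) fun q hq => ?_
      rw [mem_filter] at hq
      have ho := hout q hq.1
      refine ⟨ho.1, ho.2.1, fun e => ho.2.2 ⟨i, e.symm⟩, ?_⟩
      rcases hq.2.2 with h | h
      · exact hsnd i q hq.1 h ▸ ho.2.1
      · exact h
    omega

/-! ### Return to strong edge colourings -/

/-- Colours of the edges, listed by their ends in `B`, that separate conflicting edges give a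
strong edge colouring. -/
theorem isStrongEdgeColoring_of_edgeConflict {G : SimpleGraph V} {B : Set V}
    (hbip : ∀ x y, G.Adj x y → (x ∈ B ↔ y ∉ B)) {C : Type v} {r : G.edgeSet → V × V}
    (hr : ∀ e, (r e).1 ∈ B ∧ s((r e).1, (r e).2) = (e : Sym2 V)) {ψ : V × V → C}
    (hψ : ∀ e f, G.EdgeConflict (r e) (r f) → ψ (r e) ≠ ψ (r f)) :
    G.IsStrongEdgeColoring fun e => ψ (r e) := by
  have hradj : ∀ e, G.Adj (r e).1 (r e).2 := fun e => by
    have h := e.2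
    rw [← (hr e).2] at h
    exact h
  have key : ∀ (e f : G.edgeSet) (x y : V), x ∈ (e : Sym2 V) → y ∈ (f : Sym2 V) →
      x = y ∨ G.Adj x y → ψ (r e) = ψ (r f) → e = f := by
    intro e f x y hx hy hxy hc
    by_contra hne
    refine hψ e f ⟨fun h => hne (Subtype.ext ?_), ?_⟩ hc
    · rw [← (hr e).2, ← (hr f).2, h]
    · rw [← (hr e).2, Sym2.mem_iff] at hx
      rw [← (hr f).2, Sym2.mem_iff] at hy
      have he := hradj e
      have hf := hradj f
      have he1 := (hr e).1
      have hf1 := (hr f).1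
      have he2 := (hbip _ _ he).1 he1
      have hf2 := (hbip _ _ hf).1 hf1
      have hb := hbip x y
      rcases hx with rfl | rfl <;> rcases hy with rfl | rfl <;> rcases hxy with h | h
      · exact Or.inl (h ▸ hf)
      · exact absurd hf1 ((hb h).1 he1)
      · exact absurd (h ▸ he1) hf2
      · exact Or.inl h
      · exact absurd (h ▸ hf1) he2
      · exact Or.inr h.symm
      · exact Or.inl (h ▸ he)
      · exact absurd ((hb h).2 hf2) he2
  intro c
  constructor
  · rintro x ⟨y, hy, hc⟩
    refine ⟨y, ⟨hy, hc⟩, ?_⟩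
    rintro w ⟨hw, hwc⟩
    have h := key ⟨s(x, w), hw⟩ ⟨s(x, y), hy⟩ x x (Sym2.mem_mk_left _ _) (Sym2.mem_mk_left _ _)
      (Or.inl rfl) (hwc.trans hc.symm)
    exact Sym2.congr_right.1 (congrArg Subtype.val h)
  · rintro x ⟨x', hx, hxc⟩ y ⟨y', hy, hyc⟩ hxy
    have h := key ⟨s(x, x'), hx⟩ ⟨s(y, y'), hy⟩ x y (Sym2.mem_mk_left _ _) (Sym2.mem_mk_left _ _)
      (Or.inr hxy) (hxc.trans hyc.symm)
    have h' : s(x, x') = s(y, y') := congrArg Subtype.val h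
    have hy' : y ∈ s(x, x') := h' ▸ Sym2.mem_mk_left _ _
    rcases Sym2.mem_iff.1 hy' with rfl | rfl
    · exact absurd rfl hxy.ne
    · exact ⟨hx, hxc⟩

theorem isStrongEdgeChoosable_six [Finite V] (G : SimpleGraph V) [G.LocallyFinite]
    (hG : G.IsDegreeBoundedBipartite 2 3) : IsStrongEdgeChoosable.{u, v} G 6 := by
  classical
  obtain ⟨A, B, -, hbw, hdA, hdB⟩ := hG
  intro C L hL
  rcases isEmpty_or_nonempty C with hC | hC
  · refine ⟨fun e => ?_, fun c => hC.elim c, fun e => ?_⟩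
    all_goals exact absurd (hL e) (by simp [Set.eq_empty_of_isEmpty])
  have hbip : ∀ x y, G.Adj x y → (x ∈ B ↔ y ∉ B) := by
    intro x y h
    have hd := Set.disjoint_left.1 hbw.disjoint
    rcases hbw.mem_of_adj h with ⟨h1, h2⟩ | ⟨h1, h2⟩
    · exact iff_of_false (hd h1) (not_not.2 h2)
    · exact iff_of_true h1 (hd h2)
  have hA : ∀ b ∈ B, ∀ a x y, G.Adj b a → G.Adj x a → G.Adj y a → x ≠ b → y ≠ b → x = y := by
    intro b hb a x y h1 h2 h3 hx hy
    have haA : a ∈ A := by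
      rcases hbw.mem_of_adj h1 with ⟨h, h'⟩ | ⟨h, h'⟩
      · exact absurd hb (Set.disjoint_left.1 hbw.disjoint h)
      · exact h'
    by_contra hxy
    have hsub : ({b, x, y} : Finset V) ⊆ G.neighborFinset a := by
      intro w hw
      simp only [mem_insert, mem_singleton] at hw
      rw [mem_neighborFinset]
      rcases hw with rfl | rfl | rfl
      exacts [h1.symm, h2.symm, h3.symm]
    have h4 := card_le_card hsub
    rw [G.card_neighborFinset_eq_degree,
      card_eq_three.2 ⟨b, x, y, hx.symm, hy.symm, hxy, rfl⟩] at h4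
    have := hdA a haA
    omega
  have hT : ∀ e, ∃ T : Finset C, #T = 6 ∧ (T : Set C) ⊆ L e := by
    intro e
    obtain ⟨t, ht, htc⟩ := Set.exists_subset_encard_eq (hL e)
    have hfin : t.Finite := Set.finite_of_encard_eq_coe htc
    refine ⟨hfin.toFinset, ?_, by simpa using ht⟩
    rw [hfin.encard_eq_coe_toFinset_card] at htc
    exact_mod_cast htc
  choose T hT6 hTL using hT
  have hr : ∀ e : G.edgeSet, ∃ p : V × V, p.1 ∈ B ∧ s(p.1, p.2) = (e : Sym2 V) := by
    rintro ⟨e, he⟩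
    induction e with
    | h x y =>
      rcases hbw.mem_of_adj he with ⟨-, h⟩ | ⟨h, -⟩
      · exact ⟨(y, x), h, Sym2.eq_swap⟩
      · exact ⟨(x, y), h, rfl⟩
  choose r hr using hr
  have hradj : ∀ e, G.Adj (r e).1 (r e).2 := fun e => by
    have h := e.2
    rw [← (hr e).2] at h
    exact h
  have := Fintype.ofFinite V
  obtain ⟨ψ, hψL, hψ⟩ := listColorable_six hA hdB
    (L := fun p => if h : G.Adj p.1 p.2 then T ⟨s(p.1, p.2), h⟩ else ∅)
    (F := {p | p.1 ∈ B ∧ G.Adj p.1 p.2}) (fun q hq => by simpa using hq)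
    (fun b a h => by simp [h, hT6])
  have hrF : ∀ e, r e ∈ ({p | p.1 ∈ B ∧ G.Adj p.1 p.2} : Finset (V × V)) := fun e => by
    simpa using ⟨(hr e).1, hradj e⟩
  refine ⟨fun e => ψ (r e), isStrongEdgeColoring_of_edgeConflict hbip hr
    fun e f => hψ _ (hrF e) _ (hrF f), fun e => ?_⟩
  have h1 := hψL _ (hrF e)
  dsimp only at h1
  rw [dif_pos (hradj e)] at h1
  have h2 : (⟨s((r e).1, (r e).2), hradj e⟩ : G.edgeSet) = e := Subtype.ext (hr e).2
  rw [h2] at h1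
  exact hTL e h1

end SimpleGraph

theorem theorem1p4 {V : Type u} [Finite V] (G : SimpleGraph V) [G.LocallyFinite]
    (hG : G.IsDegreeBoundedBipartite 2 3) :
    SimpleGraph.listStrongChromaticIndex.{u, v} G ≤ 6 :=
  iInf₂_le 6 (SimpleGraph.isStrongEdgeChoosable_six.{u, v} G hG)
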